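/- For every fixed real $\varepsilon>0$ there are $\delta>0$, $\eta>0$ and $C>0$, depending only on $\varepsilon$, with the following property. Let $p$ be a prime, let $H\ge 1$ be an integer with $H>p^{\varepsilon}$, and let $\mathcal G\subseteq\mathbb F_p^*$ be a multiplicative subgroup of order $T>p^{1/2-\delta}$. Put $\mathcal I=\{1,\ldots,H\}$. Then for all $a\in\mathbb F_p^*$ and all nonprincipal multiplicative characters $\chi$ of $\mathbb F_p$ (extended by $\chi(0)=0$), the sum $$S_\chi(a,\mathcal I,\mathcal G)=\sum_{x\in\mathcal I}\ \sum_{\lambda\in\mathcal G}\chi(x+a\lambda)$$ satisfies $$|S_\chi(a,\mathcal I,\mathcal G)|\le C\,H\,T\,p^{-\eta}.$$ -/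

import Mathlib

/-- The double character sum `S_χ(a, I, G) = ∑_{x ∈ I} ∑_{lam ∈ G} χ(x + a * lam)` over the interval
`I = {1, …, H}` of consecutive integers and a multiplicative subgroup `G` of `𝔽_p^*`.
As usual `χ` is extended by `χ(0) = 0`, which is built into `MulChar`. -/
noncomputable def doubleCharSum {p : ℕ} [Fact p.Prime] (χ : MulChar (ZMod p) ℂ)
    (a : (ZMod p)ˣ) (H : ℕ) (G : Subgroup (ZMod p)ˣ) : ℂ :=
  open Classical in
  ∑ x ∈ Finset.Icc 1 H, ∑ lam : G,
    χ ((x : ZMod p) + (a : ZMod p) * (((lam : G) : (ZMod p)ˣ) : ZMod p))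

/-! Put F(z) = ∑_λ χ(z + aλ), so that S = ∑_{x ≤ H} F(x). Since |F| is invariant under
multiplication by G, each |F(x)| may be averaged over the points x/μ, μ ∈ G. Cauchy–Schwarz, with
ν(z) the number of representations z = x/μ, combines with the second moment ∑|F|² ≤ pT into |S|² ≤
H·p·max ν.

When H < p, ν(z) for z ≠ 0 counts the elements of {1, …, H} in the coset zG. Their k-fold products
lie in the single coset z^k G and in [1, H^k], and an integer n arises at most d(n)^k times. With p
≤ H^k this gives ν ≪ H (T/p)^{1/k} up to a small power of p, which beats HT²/p by a power of p even
for T slightly below p^{1/2}. When H ≥ p, counting residues directly suffices. -/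

/-! ### Character sums: correlations, second moment, Cauchy–Schwarz. -/

theorem sum_mulChar_add_mul_inv_add {p : ℕ} [Fact p.Prime] {χ : MulChar (ZMod p) ℂ} (hχ : χ ≠ 1)
    {b c : ZMod p} (hbc : b ≠ c) : ∑ z, χ (z + b) * χ⁻¹ (z + c) = -1 := by
  have hd : b - c ≠ 0 := sub_ne_zero.mpr hbc
  have key : ∑ z, χ (z + b) * χ⁻¹ (z + c)
      = ∑ x, χ⁻¹ (-1) * (χ x * χ⁻¹ (1 - x)) := by
    -- The substitution z = (b - c)x - b turns the correlation into χ(-1)⁻¹ times the Jacobi sum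
    -- J(χ, χ⁻¹) = -χ(-1).
    refine (Fintype.sum_equiv ((Equiv.mulLeft₀ _ hd).trans (Equiv.subRight b)) _ _ fun x => ?_).symm
    have h1 : (b - c) * x - b + b = (b - c) * x := by ring
    have h2 : (b - c) * x - b + c = (b - c) * (-1 * (1 - x)) := by ring
    have h0 : Equiv.mulLeft₀ (b - c) hd x = (b - c) * x := rfl
    simp only [Equiv.trans_apply, h0, Equiv.subRight_apply, h1, h2, map_mul]
    have h3 : χ (b - c) * χ⁻¹ (b - c) = 1 := by
      rw [MulChar.inv_apply', ← map_mul, mul_inv_cancel₀ hd, map_one]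
    linear_combination -(χ⁻¹ (-1) * χ x * χ⁻¹ (1 - x)) * h3
  have h4 : χ⁻¹ (-1) * χ (-1) = 1 := by
    rw [MulChar.inv_apply', ← map_mul, inv_mul_cancel₀ (by simp), map_one]
  rw [key, ← Finset.mul_sum]
  have := jacobiSum_nontrivial_inv hχ
  rw [jacobiSum] at this
  rw [this]
  linear_combination -h4

/-- Expanding the square, each diagonal term is at most p, while each off-diagonal correlation is -1
and can be dropped. -/
theorem sum_norm_sum_mulChar_sq_le {p : ℕ} [Fact p.Prime] {χ : MulChar (ZMod p) ℂ} (hχ : χ ≠ 1)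
    {ι : Type*} [Fintype ι] {f : ι → ZMod p} (hf : Function.Injective f) :
    ∑ z, ‖∑ i, χ (z + f i)‖ ^ 2 ≤ (p : ℝ) * Fintype.card ι := by
  classical
  have expand : ∀ z, ‖∑ i, χ (z + f i)‖ ^ 2
      = ∑ i, ∑ j, (χ (z + f i) * χ⁻¹ (z + f j)).re := by
    intro z
    have : ((‖∑ i, χ (z + f i)‖ ^ 2 : ℝ) : ℂ) = ∑ i, ∑ j, χ (z + f i) * χ⁻¹ (z + f j) := by
      rw [← Finset.sum_mul_sum]
      simp_rw [← MulChar.star_apply']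
      push_cast
      rw [← Complex.mul_conj', ← star_sum]
      rfl
    have h := congrArg Complex.re this
    simpa only [Complex.ofReal_re, Complex.re_sum] using h
  have entry : ∀ i j, ∑ z, (χ (z + f i) * χ⁻¹ (z + f j)).re ≤ if i = j then (p : ℝ) else 0 := by
    intro i j
    split_ifs with hij
    · subst hij
      calc _ ≤ ∑ z : ZMod p, (1 : ℝ) := by
            refine Finset.sum_le_sum fun z _ => (Complex.re_le_norm _).trans ?_
            rw [norm_mul]
            exact mul_le_one₀ (DirichletCharacter.norm_le_one χ _) (norm_nonneg _)
              (DirichletCharacter.norm_le_one χ⁻¹ _)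
        _ = p := by simp [ZMod.card]
    · rw [← Complex.re_sum, sum_mulChar_add_mul_inv_add hχ (hf.ne hij)]
      simp
  calc ∑ z, ‖∑ i, χ (z + f i)‖ ^ 2
      = ∑ i, ∑ j, ∑ z, (χ (z + f i) * χ⁻¹ (z + f j)).re := by
        simp_rw [expand]
        rw [Finset.sum_comm]
        exact Finset.sum_congr rfl fun i _ => Finset.sum_comm
    _ ≤ ∑ i : ι, ∑ j, if i = j then (p : ℝ) else 0 :=
        Finset.sum_le_sum fun i _ => Finset.sum_le_sum fun j _ => entry i j
    _ = p * Fintype.card ι := by simp [mul_comm]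

/-- The pairs `(x, μ)` in `{1, …, H} × G` with `x = z * μ`. -/
noncomputable def quotientFiber {p : ℕ} (H : ℕ) (G : Subgroup (ZMod p)ˣ) [Fintype G]
    (z : ZMod p) : Finset (ℕ × G) :=
  open Classical in
  {q ∈ Finset.Icc 1 H ×ˢ Finset.univ | (q.1 : ZMod p) = z * ((q.2 : (ZMod p)ˣ) : ZMod p)}

theorem mem_quotientFiber {p : ℕ} {H : ℕ} {G : Subgroup (ZMod p)ˣ} [Fintype G] {z : ZMod p}
    {q : ℕ × G} : q ∈ quotientFiber H G z ↔
      (1 ≤ q.1 ∧ q.1 ≤ H) ∧ (q.1 : ZMod p) = z * ((q.2 : (ZMod p)ˣ) : ZMod p) := by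
  simp [quotientFiber]

theorem norm_doubleCharSum_sq_le {p : ℕ} [Fact p.Prime] {χ : MulChar (ZMod p) ℂ} (hχ : χ ≠ 1)
    (a : (ZMod p)ˣ) (H : ℕ) (G : Subgroup (ZMod p)ˣ) [Fintype G] {N : ℝ}
    (hN : ∀ z, ((quotientFiber H G z).card : ℝ) ≤ N) :
    ‖doubleCharSum χ a H G‖ ^ 2 ≤ H * N * p := by
  classical
  set F : ZMod p → ℂ := fun z => ∑ lam : G, χ (z + (a : ZMod p) * ((lam : (ZMod p)ˣ) : ZMod p))
    with hF
  set φ : ℕ × G → ZMod p := fun q => q.1 * (((q.2 : (ZMod p)ˣ)⁻¹ : (ZMod p)ˣ) : ZMod p) with hφ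
  set P : Finset (ℕ × G) := Finset.Icc 1 H ×ˢ Finset.univ with hP
  have hS : doubleCharSum χ a H G = ∑ x ∈ Finset.Icc 1 H, F x := by
    unfold doubleCharSum
    refine Finset.sum_congr rfl fun x _ => ?_
    simp only [hF]
    congr!
  have scale : ∀ (x : ℕ) (m : G), ‖F x‖ = ‖F (φ (x, m))‖ := by
    intro x m
    -- Pull μ out of each argument and reindex λ ↦ μλ.
    have h1 : F x = χ ((m : (ZMod p)ˣ) : ZMod p) * F (φ (x, m)) := by
      simp only [hF, hφ, Finset.mul_sum, ← map_mul]
      refine (Fintype.sum_equiv (Equiv.mulLeft m) _ _ fun l => ?_).symm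
      congr 1
      simp only [Equiv.coe_mulLeft, Subgroup.coe_mul, Units.val_mul, mul_add]
      have : ((m : (ZMod p)ˣ) : ZMod p) * (((m : (ZMod p)ˣ)⁻¹ : (ZMod p)ˣ) : ZMod p) = 1 :=
        Units.mul_inv _
      linear_combination (x : ZMod p) * this
    have h2 : ‖χ ((m : (ZMod p)ˣ) : ZMod p)‖ = 1 := DirichletCharacter.unit_norm_eq_one χ _
    rw [h1, norm_mul, h2, one_mul]
  have hT : (0 : ℝ) < Fintype.card G := by exact_mod_cast Fintype.card_pos
  have hcardP : (P.card : ℝ) = H * Fintype.card G := by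
    rw [hP, Finset.card_product]; simp
  have step1 : Fintype.card G * ‖doubleCharSum χ a H G‖ ≤ ∑ q ∈ P, ‖F (φ q)‖ := by
    rw [hP, Finset.sum_product]
    calc _ ≤ (Fintype.card G : ℝ) * ∑ x ∈ Finset.Icc 1 H, ‖F x‖ := by
          rw [hS]; gcongr; exact norm_sum_le _ _
      _ = _ := by
          rw [Finset.mul_sum]
          refine Finset.sum_congr rfl fun x _ => ?_
          rw [Finset.sum_congr rfl fun m _ => (scale x m).symm, Finset.sum_const, Finset.card_univ,
            nsmul_eq_mul]
  have fiber : ∀ z, ({q ∈ P | φ q = z} : Finset _) = quotientFiber H G z := by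
    intro z
    ext q
    simp only [quotientFiber, Finset.mem_filter, hφ, ← hP]
    refine and_congr_right fun _ => ?_
    exact Units.mul_inv_eq_iff_eq_mul _
  have step2 : ∑ q ∈ P, ‖F (φ q)‖ ^ 2 ≤ N * (p * Fintype.card G) := by
    calc ∑ q ∈ P, ‖F (φ q)‖ ^ 2 = ∑ z, ∑ q ∈ P with φ q = z, ‖F (φ q)‖ ^ 2 :=
          (Finset.sum_fiberwise _ _ _).symm
      _ = ∑ z, (quotientFiber H G z).card * ‖F z‖ ^ 2 := by
          refine Finset.sum_congr rfl fun z _ => ?_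
          rw [← fiber z, ← nsmul_eq_mul, ← Finset.sum_const]
          refine Finset.sum_congr rfl fun q hq => ?_
          rw [(Finset.mem_filter.mp hq).2]
      _ ≤ ∑ z, N * ‖F z‖ ^ 2 := by gcongr with z; exact hN z
      _ ≤ N * (p * Fintype.card G) := by
          rw [← Finset.mul_sum]
          gcongr
          · exact (Nat.cast_nonneg _).trans (hN 0)
          · refine sum_norm_sum_mulChar_sq_le hχ fun x y hxy => ?_
            exact Subtype.ext (Units.ext (a.isUnit.mul_left_cancel hxy))
  have step3 : (Fintype.card G * ‖doubleCharSum χ a H G‖) ^ 2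
      ≤ (H * Fintype.card G) * (N * (p * Fintype.card G)) := by
    calc _ ≤ (∑ q ∈ P, ‖F (φ q)‖) ^ 2 := by gcongr
      _ ≤ P.card * ∑ q ∈ P, ‖F (φ q)‖ ^ 2 := sq_sum_le_card_mul_sum_sq
      _ ≤ _ := by rw [hcardP]; gcongr
  have h5 : (0 : ℝ) < (Fintype.card G : ℝ) ^ 2 := by positivity
  refine le_of_mul_le_mul_left ?_ h5
  calc _ = _ := (mul_pow _ _ _).symm
    _ ≤ _ := step3
    _ = _ := by ring

/-! ### The divisor bound d(n) ≪ n^κ. -/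

theorem Nat.exists_card_divisors_le_rpow {κ : ℝ} (hκ : 0 < κ) :
    ∃ C : ℝ, 1 ≤ C ∧ ∀ n : ℕ, n ≠ 0 → (n.divisors.card : ℝ) ≤ C * (n : ℝ) ^ κ := by
  have hlog : 0 < Real.log 2 := Real.log_pos one_lt_two
  set c : ℝ := max 1 (1 / (κ * Real.log 2)) with hc
  have hc1 : 1 ≤ c := le_max_left _ _
  have hc2 : 1 ≤ c * (κ * Real.log 2) := by
    rw [← div_le_iff₀ (by positivity)]; exact le_max_right _ _
  -- For q ≥ 2^{1/κ} one has q^κ ≥ 2, so e + 1 ≤ 2^e needs no constant; only the fewer than M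
  -- smaller primes cost a factor c.
  set M : ℕ := ⌈(2 : ℝ) ^ (1 / κ)⌉₊ with hM
  have local_bound : ∀ q : ℕ, 2 ≤ q → ∀ e : ℕ,
      ((e + 1 : ℕ) : ℝ) ≤ (if q < M then c else 1) * ((q ^ e : ℕ) : ℝ) ^ κ := by
    intro q hq e
    have hq' : (2 : ℝ) ≤ q := by exact_mod_cast hq
    push_cast
    rw [← Real.rpow_natCast, ← Real.rpow_mul (by positivity)]
    split_ifs with h
    · calc (e : ℝ) + 1 ≤ c * (Real.log 2 * (e * κ) + 1) := by
            nlinarith [mul_le_mul_of_nonneg_left hc2 (Nat.cast_nonneg (α := ℝ) e)]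
        _ ≤ c * (2 : ℝ) ^ ((e : ℝ) * κ) := by
            gcongr
            rw [Real.rpow_def_of_pos two_pos]
            exact Real.add_one_le_exp _
        _ ≤ c * (q : ℝ) ^ ((e : ℝ) * κ) := by gcongr
    · have h1 : (2 : ℝ) ≤ (q : ℝ) ^ κ := by
        have h2 : (2 : ℝ) ^ (1 / κ) ≤ q := Nat.ceil_le.mp (not_lt.mp h)
        calc (2 : ℝ) = ((2 : ℝ) ^ (1 / κ)) ^ κ := by
              rw [← Real.rpow_mul (by norm_num), one_div_mul_cancel hκ.ne', Real.rpow_one]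
          _ ≤ _ := by gcongr
      rw [one_mul, mul_comm, Real.rpow_mul (by positivity), Real.rpow_natCast]
      calc (e : ℝ) + 1 ≤ 2 ^ e := by exact_mod_cast Nat.lt_two_pow_self
        _ ≤ _ := by gcongr
  refine ⟨c ^ M, one_le_pow₀ hc1, fun n hn => ?_⟩
  rw [Nat.card_divisors hn, Nat.cast_prod]
  calc ∏ q ∈ n.primeFactors, ((n.factorization q + 1 : ℕ) : ℝ)
      ≤ ∏ q ∈ n.primeFactors,
          (if q < M then c else 1) * ((q ^ n.factorization q : ℕ) : ℝ) ^ κ :=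
        Finset.prod_le_prod (fun _ _ => Nat.cast_nonneg _) fun q hq =>
          local_bound q (Nat.prime_of_mem_primeFactors hq).two_le _
    _ = c ^ (n.primeFactors.filter (· < M)).card * (n : ℝ) ^ κ := by
        rw [Finset.prod_mul_distrib, Real.finsetProd_rpow _ _ fun _ _ => Nat.cast_nonneg _,
          ← Nat.cast_prod, ← Finset.prod_filter, Finset.prod_const]
        congr 3
        exact Nat.prod_factorization_pow_eq_self hn
    _ ≤ c ^ M * (n : ℝ) ^ κ := by
        gcongr
        calc _ ≤ (Finset.range M).card := Finset.card_le_card fun q hq =>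
                Finset.mem_range.mpr (Finset.mem_filter.mp hq).2
          _ = M := Finset.card_range M

/-! ### Counting small integers in cosets of G. -/

theorem card_filter_natCast_eq_le {p : ℕ} [NeZero p] (L : ℕ) (r : ZMod p) :
    ((Finset.Icc 1 L).filter fun n : ℕ => (n : ZMod p) = r).card ≤ L / p + 1 := by
  rw [← Finset.card_range (L / p + 1)]
  refine Finset.card_le_card_of_injOn (· / p) (fun n hn => ?_) fun m hm n hn hmn => ?_
  · simp only [Finset.coe_filter, Finset.mem_Icc, Set.mem_ofPred_eq] at hn
    simpa [Nat.lt_succ_iff] using Nat.div_le_div_right hn.1.2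
  · simp only [Finset.coe_filter, Set.mem_ofPred_eq] at hm hn
    have h : m % p = n % p := (ZMod.natCast_eq_natCast_iff' m n p).mp (hm.2.trans hn.2.symm)
    have hmn' : m / p = n / p := hmn
    rw [← Nat.div_add_mod m p, ← Nat.div_add_mod n p, h, hmn']

theorem mul_card_filter_natCast_mem_le {p : ℕ} [NeZero p] (L : ℕ) (R : Finset (ZMod p)) :
    p * ((Finset.Icc 1 L).filter fun n : ℕ => (n : ZMod p) ∈ R).card ≤ R.card * (L + p) := by
  have h := Finset.card_le_mul_card_image_of_maps_to (t := R) (f := fun n : ℕ => (n : ZMod p))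
    (s := (Finset.Icc 1 L).filter fun n : ℕ => (n : ZMod p) ∈ R)
    (fun n hn => (Finset.mem_filter.mp hn).2) (L / p + 1) fun r _ =>
      (Finset.card_le_card fun n hn => by
        simp only [Finset.mem_filter] at hn ⊢
        exact ⟨hn.1.1, hn.2⟩).trans (card_filter_natCast_eq_le L r)
  calc _ ≤ p * ((L / p + 1) * R.card) := Nat.mul_le_mul_left _ h
    _ = R.card * (p * (L / p) + p) := by ring
    _ ≤ _ := by gcongr; exact Nat.mul_div_le L p

/-- Multiply k-tuples from A: the product stays in z^k G, which has at most T residues, and every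
factor of a tuple with product n divides n. -/
theorem mul_card_pow_le_of_subset_coset {p : ℕ} [NeZero p] {H k D : ℕ}
    (G : Subgroup (ZMod p)ˣ) [Fintype G] (z : ZMod p) {A : Finset ℕ}
    (hA : ∀ x ∈ A, (1 ≤ x ∧ x ≤ H) ∧ ∃ m : G, (x : ZMod p) = z * ((m : (ZMod p)ˣ) : ZMod p))
    (hD : ∀ n, 1 ≤ n → n ≤ H ^ k → n.divisors.card ≤ D) :
    p * A.card ^ k ≤ D ^ k * (Fintype.card G * (H ^ k + p)) := by
  classical
  set R : Finset (ZMod p) :=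
    Finset.univ.image fun m : G => z ^ k * ((m : (ZMod p)ˣ) : ZMod p) with hR
  have hRcard : R.card ≤ Fintype.card G := Finset.card_image_le
  set B := (Finset.Icc 1 (H ^ k)).filter fun n : ℕ => (n : ZMod p) ∈ R with hB
  have maps : ∀ f ∈ Fintype.piFinset fun _ : Fin k => A, ∏ i, f i ∈ B := by
    intro f hf
    rw [Fintype.mem_piFinset] at hf
    choose m hm using fun i => (hA _ (hf i)).2
    rw [hB, Finset.mem_filter, Finset.mem_Icc]
    refine ⟨⟨Finset.one_le_prod' fun i _ => (hA _ (hf i)).1.1, ?_⟩, ?_⟩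
    · simpa using Finset.prod_le_pow_card Finset.univ f H fun i _ => (hA _ (hf i)).1.2
    · rw [hR, Finset.mem_image]
      refine ⟨∏ i, m i, Finset.mem_univ _, ?_⟩
      rw [Nat.cast_prod, Finset.prod_congr rfl fun i _ => hm i, Finset.prod_mul_distrib]
      simp
  have fiber : ∀ n ∈ B, ((Fintype.piFinset fun _ : Fin k => A).filter
      fun f => ∏ i, f i = n).card ≤ D ^ k := by
    intro n hn
    rw [hB, Finset.mem_filter, Finset.mem_Icc] at hn
    calc _ ≤ (Fintype.piFinset fun _ : Fin k => n.divisors).card := by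
          refine Finset.card_le_card fun f hf => ?_
          rw [Finset.mem_filter] at hf
          refine Fintype.mem_piFinset.mpr fun i => Nat.mem_divisors.mpr ⟨?_, by omega⟩
          rw [← hf.2]
          exact Finset.dvd_prod_of_mem f (Finset.mem_univ i)
      _ = n.divisors.card ^ k := by simp
      _ ≤ D ^ k := Nat.pow_le_pow_left (hD n hn.1.1 hn.1.2) k
  have h := Finset.card_le_mul_card_image_of_maps_to maps (D ^ k) fiber
  rw [Fintype.card_piFinset_const] at h
  calc p * A.card ^ k ≤ p * (D ^ k * B.card) := Nat.mul_le_mul_left _ h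
    _ = D ^ k * (p * B.card) := by ring
    _ ≤ D ^ k * (R.card * (H ^ k + p)) := by
        exact Nat.mul_le_mul_left _ (mul_card_filter_natCast_mem_le (H ^ k) R)
    _ ≤ _ := by gcongr

/-- Each μ fixes x mod p. This crude count serves the range H ≥ p. -/
theorem mul_card_quotientFiber_le {p : ℕ} [NeZero p] (H : ℕ) (G : Subgroup (ZMod p)ˣ)
    [Fintype G] (z : ZMod p) :
    p * (quotientFiber H G z).card ≤ Fintype.card G * (H + p) := by
  classical
  have h := Finset.card_le_mul_card_image_of_maps_to (s := quotientFiber H G z)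
    (t := Finset.univ) (f := Prod.snd) (fun _ _ => Finset.mem_univ _) (H / p + 1) fun m _ => by
      refine le_trans ?_ (card_filter_natCast_eq_le H (z * ((m : (ZMod p)ˣ) : ZMod p)))
      refine Finset.card_le_card_of_injOn Prod.fst (fun q hq => ?_) fun q hq q' hq' h => ?_
      · simp only [Finset.coe_filter, mem_quotientFiber, Set.mem_ofPred_eq] at hq
        obtain ⟨hq, rfl⟩ := hq
        simpa using hq
      · simp only [Finset.coe_filter, Set.mem_ofPred_eq] at hq hq'
        exact Prod.ext h (hq.2.trans hq'.2.symm)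
  calc _ ≤ p * ((H / p + 1) * Fintype.card G) := Nat.mul_le_mul_left _ h
    _ = Fintype.card G * (p * (H / p) + p) := by ring
    _ ≤ _ := by gcongr; exact Nat.mul_div_le H p

theorem mul_card_quotientFiber_pow_le {p : ℕ} [Fact p.Prime] {H k D : ℕ} (hHp : H < p)
    (G : Subgroup (ZMod p)ˣ) [Fintype G] (z : ZMod p)
    (hD : ∀ n, 1 ≤ n → n ≤ H ^ k → n.divisors.card ≤ D) :
    p * (quotientFiber H G z).card ^ k ≤ D ^ k * (Fintype.card G * (H ^ k + p)) := by
  classical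
  have hinj : Set.InjOn Prod.fst (quotientFiber H G z : Set (ℕ × G)) := by
    rintro ⟨x, m⟩ hq ⟨x', m'⟩ hq' h
    obtain rfl : x = x' := h
    rw [Finset.mem_coe, mem_quotientFiber] at hq hq'
    -- As H < p, x is invertible mod p, so x and z determine μ.
    have hx : (x : ZMod p) ≠ 0 := fun h0 =>
      Nat.not_dvd_of_pos_of_lt hq.1.1 (hq.1.2.trans_lt hHp) ((ZMod.natCast_eq_zero_iff x p).mp h0)
    have hz : z ≠ 0 := by
      rintro rfl
      exact hx (by simpa using hq.2)
    have hm := mul_left_cancel₀ hz (hq.2.symm.trans hq'.2)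
    exact Prod.ext rfl (Subtype.ext (Units.ext hm))
  rw [← Finset.card_image_of_injOn hinj]
  refine mul_card_pow_le_of_subset_coset G z (fun x hx => ?_) hD
  obtain ⟨q, hq, rfl⟩ := Finset.mem_image.mp hx
  rw [mem_quotientFiber] at hq
  exact ⟨hq.1, q.2, hq.2⟩

/-! ### Choice of exponents and conclusion. -/

theorem rpow_mul_rpow_le_sq_mul_rpow {P T c : ℝ} (hP : 1 ≤ P) (hc0 : 0 ≤ c) (hc1 : c ≤ 1)
    (hT : P ^ (1 / 2 - c / 8) ≤ T) : P ^ (1 - 7 * c / 8) * T ^ c ≤ T ^ 2 * P ^ (-(c / 8)) := by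
  have hP0 : 0 < P := by linarith
  have hT0 : 0 < T := (Real.rpow_pos_of_pos hP0 _).trans_le hT
  have h1 : P ^ (1 - 3 * c / 4) ≤ T ^ (2 - c) := by
    calc P ^ (1 - 3 * c / 4) ≤ P ^ ((1 / 2 - c / 8) * (2 - c)) :=
          -- (1/2 - c/8)(2 - c) = 1 - 3c/4 + c²/8.
          Real.rpow_le_rpow_of_exponent_le hP (by nlinarith)
      _ = (P ^ (1 / 2 - c / 8)) ^ (2 - c) := Real.rpow_mul hP0.le _ _
      _ ≤ T ^ (2 - c) := Real.rpow_le_rpow (by positivity) hT (by linarith)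
  calc P ^ (1 - 7 * c / 8) * T ^ c = P ^ (1 - 3 * c / 4) * (P ^ (-(c / 8)) * T ^ c) := by
        rw [← mul_assoc, ← Real.rpow_add hP0]; ring_nf
    _ ≤ T ^ (2 - c) * (P ^ (-(c / 8)) * T ^ c) := by gcongr
    _ = (T ^ (2 - c) * T ^ c) * P ^ (-(c / 8)) := by ring
    _ = _ := by
        rw [← Real.rpow_add hT0, sub_add_cancel, Real.rpow_two]

theorem card_quotientFiber_le_rpow {p : ℕ} [Fact p.Prime] {H k : ℕ} (hk : k ≠ 0) (hHp : H < p)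
    (hpH : p ≤ H ^ k) (G : Subgroup (ZMod p)ˣ) [Fintype G] {C : ℝ} (hC : 0 ≤ C)
    (hdiv : ∀ n : ℕ, n ≠ 0 → (n.divisors.card : ℝ) ≤ C * (n : ℝ) ^ (1 / (8 * (k : ℝ) ^ 2)))
    (z : ZMod p) : ((quotientFiber H G z).card : ℝ) ≤
      2 * C * H * (p : ℝ) ^ (-(7 * (1 / (k : ℝ)) / 8)) * (Fintype.card G : ℝ) ^ (1 / (k : ℝ)) := by
  have hp0 : (0 : ℝ) < p := by exact_mod_cast (Fact.out : p.Prime).pos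
  have hk0 : (0 : ℝ) < k := by exact_mod_cast Nat.pos_of_ne_zero hk
  set T : ℝ := ((Fintype.card G : ℕ) : ℝ) with hT
  -- Since n ≤ H^k ≤ p^k, the exponent 1/(8k²) in n becomes 1/(8k) in p.
  set D : ℕ := ⌊C * (p : ℝ) ^ (1 / (8 * (k : ℝ)))⌋₊ with hDdef
  have hD : ∀ n, 1 ≤ n → n ≤ H ^ k → n.divisors.card ≤ D := by
    intro n hn1 hn
    refine Nat.le_floor ((hdiv n (by omega)).trans ?_)
    gcongr
    calc (n : ℝ) ^ (1 / (8 * (k : ℝ) ^ 2)) ≤ ((p : ℝ) ^ (k : ℝ)) ^ (1 / (8 * (k : ℝ) ^ 2)) := by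
          gcongr
          rw [Real.rpow_natCast]
          exact_mod_cast hn.trans (Nat.pow_le_pow_left hHp.le k)
      _ = _ := by
          rw [← Real.rpow_mul hp0.le]
          congr 1
          field_simp
  have hDle : (D : ℝ) ≤ C * (p : ℝ) ^ (1 / (8 * (k : ℝ))) := Nat.floor_le (by positivity)
  have h := mul_card_quotientFiber_pow_le hHp G z hD
  set ν := (quotientFiber H G z).card with hν
  have h' : (p : ℝ) * (ν : ℝ) ^ k ≤ (D : ℝ) ^ k * (T * (H ^ k + p)) := by
    rw [hT]
    exact_mod_cast h
  have hpH' : (p : ℝ) ≤ (H : ℝ) ^ k := by exact_mod_cast hpH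
  refine le_of_pow_le_pow_left₀ hk (by positivity) (le_of_mul_le_mul_left (h'.trans ?_) hp0)
  have e1 : ((p : ℝ) ^ (-(7 * (1 / (k : ℝ)) / 8))) ^ k * p
      = ((p : ℝ) ^ (1 / (8 * (k : ℝ)))) ^ k := by
    rw [← Real.rpow_mul_natCast hp0.le, ← Real.rpow_mul_natCast hp0.le]
    nth_rewrite 2 [← Real.rpow_one (p : ℝ)]
    rw [← Real.rpow_add hp0]
    congr 1
    field_simp
    norm_num
  have e2 : (T ^ (1 / (k : ℝ))) ^ k = T := by
    rw [← Real.rpow_mul_natCast (by positivity), one_div_mul_cancel hk0.ne', Real.rpow_one]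
  -- The 2 from H^k + p ≤ 2H^k is enlarged to 2^k so that the k-th root is clean.
  have h2 : (2 : ℝ) ≤ 2 ^ k := by
    simpa using pow_le_pow_right₀ (one_le_two (α := ℝ)) (Nat.one_le_iff_ne_zero.mpr hk)
  calc (D : ℝ) ^ k * (T * (H ^ k + p))
      ≤ (C * (p : ℝ) ^ (1 / (8 * (k : ℝ)))) ^ k * (T * (H ^ k + H ^ k)) := by gcongr
    _ = C ^ k * ((p : ℝ) ^ (1 / (8 * (k : ℝ)))) ^ k * T * H ^ k * 2 := by ring
    _ ≤ C ^ k * ((p : ℝ) ^ (1 / (8 * (k : ℝ)))) ^ k * T * H ^ k * 2 ^ k := by gcongr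
    _ = _ := by
        rw [mul_pow, mul_pow, mul_pow, mul_pow, e2, ← e1]
        ring

theorem norm_doubleCharSum_le_rpow {p : ℕ} [Fact p.Prime] {χ : MulChar (ZMod p) ℂ} (hχ : χ ≠ 1)
    (a : (ZMod p)ˣ) {H k : ℕ} (hk : k ≠ 0) (hpH : p ≤ H ^ k) (G : Subgroup (ZMod p)ˣ)
    [Fintype G] {C : ℝ} (hC : 1 ≤ C)
    (hdiv : ∀ n : ℕ, n ≠ 0 → (n.divisors.card : ℝ) ≤ C * (n : ℝ) ^ (1 / (8 * (k : ℝ) ^ 2)))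
    (hT : (p : ℝ) ^ (1 / 2 - 1 / (k : ℝ) / 8) ≤ Fintype.card G) :
    ‖doubleCharSum χ a H G‖ ≤
      2 * C * (H * Fintype.card G * (p : ℝ) ^ (-(1 / (k : ℝ) / 16))) := by
  have hp1 : (1 : ℝ) ≤ p := by exact_mod_cast (Fact.out : p.Prime).one_le
  have hp0 : (0 : ℝ) < p := by linarith
  set c : ℝ := 1 / (k : ℝ) with hc
  have hc0 : 0 ≤ c := by positivity
  have hc1 : c ≤ 1 := by
    have : (1 : ℝ) ≤ k := by exact_mod_cast Nat.one_le_iff_ne_zero.mpr hk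
    rw [hc, div_le_one (by linarith)]
    exact this
  set T : ℝ := ((Fintype.card G : ℕ) : ℝ) with hTdef
  have hT0 : 0 < T := (Real.rpow_pos_of_pos hp0 _).trans_le hT
  suffices h : ‖doubleCharSum χ a H G‖ ^ 2 ≤ 2 * C * (H ^ 2 * (T ^ 2 * (p : ℝ) ^ (-(c / 8)))) by
    refine le_of_sq_le_sq (h.trans ?_) (by positivity)
    have e : (p : ℝ) ^ (-(c / 8)) = ((p : ℝ) ^ (-(c / 16))) ^ 2 := by
      rw [← Real.rpow_mul_natCast hp0.le]
      congr 1
      push_cast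
      ring
    -- 2C ≥ 1, so 2C may be replaced by its square before taking roots.
    calc _ ≤ (2 * C) ^ 2 * (H ^ 2 * (T ^ 2 * (p : ℝ) ^ (-(c / 8)))) := by
          gcongr
          nlinarith
      _ = _ := by rw [e]; ring
  rcases lt_or_ge H p with hHp | hHp
  · refine (norm_doubleCharSum_sq_le hχ a H G
      (card_quotientFiber_le_rpow hk hHp hpH G (by linarith) hdiv)).trans ?_
    have e : (p : ℝ) ^ (1 - 7 * c / 8) = p * (p : ℝ) ^ (-(7 * c / 8)) := by
      rw [sub_eq_add_neg, Real.rpow_add hp0, Real.rpow_one]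
    calc _ = 2 * C * (H ^ 2 * ((p : ℝ) ^ (1 - 7 * c / 8) * T ^ c)) := by rw [e]; ring
      _ ≤ _ := by
          have := rpow_mul_rpow_le_sq_mul_rpow hp1 hc0 hc1 hT
          gcongr 2 * C * (H ^ 2 * ?_)
  · have hHp' : (p : ℝ) ≤ H := by exact_mod_cast hHp
    have hN : ∀ z, ((quotientFiber H G z).card : ℝ) ≤ T * (2 * H) / p := by
      intro z
      rw [le_div_iff₀' hp0]
      have h : (p : ℝ) * (quotientFiber H G z).card ≤ T * (H + p) := by
        rw [hTdef]
        exact_mod_cast mul_card_quotientFiber_le H G z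
      refine h.trans ?_
      gcongr
      linarith
    refine (norm_doubleCharSum_sq_le hχ a H G hN).trans ?_
    have hTle : T ≤ T ^ 2 * (p : ℝ) ^ (-(c / 8)) := by
      have h1 : (p : ℝ) ^ (c / 8) ≤ T :=
        (Real.rpow_le_rpow_of_exponent_le hp1 (by linarith)).trans hT
      rw [Real.rpow_neg hp0.le, ← div_eq_mul_inv, le_div_iff₀ (by positivity), sq]
      gcongr
    calc _ = 2 * (H ^ 2 * T) := by field_simp
      _ ≤ 2 * C * (H ^ 2 * (T ^ 2 * (p : ℝ) ^ (-(c / 8)))) := by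
          gcongr
          linarith

theorem theorem1 :
    ∀ ε : ℝ, 0 < ε →
      ∃ δ : ℝ, 0 < δ ∧ ∃ η : ℝ, 0 < η ∧ ∃ C : ℝ, 0 < C ∧
        ∀ (p : ℕ) [Fact p.Prime] (H T : ℕ) (G : Subgroup (ZMod p)ˣ),
          Nat.card G = T →
          (p : ℝ) ^ ε < (H : ℝ) →
          (p : ℝ) ^ (1 / 2 - δ) < (T : ℝ) →
          ∀ (a : (ZMod p)ˣ) (χ : MulChar (ZMod p) ℂ), χ ≠ 1 →
            ‖doubleCharSum χ a H G‖ ≤ C * ((H : ℝ) * (T : ℝ) * (p : ℝ) ^ (-η)) := by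
  intro ε hε
  -- Then εk ≥ 1, so H > p^ε forces H^k ≥ p.
  set k : ℕ := ⌈1 / ε⌉₊ with hkdef
  have hk : 0 < k := Nat.ceil_pos.mpr (by positivity)
  have hk0 : (0 : ℝ) < k := by exact_mod_cast hk
  have hkε : 1 ≤ ε * k := by
    rw [← div_le_iff₀' hε]
    exact Nat.le_ceil _
  obtain ⟨C, hC, hdiv⟩ :=
    Nat.exists_card_divisors_le_rpow (κ := 1 / (8 * (k : ℝ) ^ 2)) (by positivity)
  refine ⟨1 / (k : ℝ) / 8, by positivity, 1 / (k : ℝ) / 16, by positivity, 2 * C, by linarith, ?_⟩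
  rintro p _ H T G rfl hH hT a χ hχ
  have : Fintype G := Fintype.ofFinite G
  rw [Nat.card_eq_fintype_card] at hT ⊢
  have hp1 : (1 : ℝ) ≤ p := by exact_mod_cast (Fact.out : p.Prime).one_le
  refine norm_doubleCharSum_le_rpow hχ a hk.ne' ?_ G hC hdiv hT.le
  have h : (p : ℝ) ≤ (H : ℝ) ^ k := by
    calc (p : ℝ) = (p : ℝ) ^ (1 : ℝ) := (Real.rpow_one _).symm
      _ ≤ (p : ℝ) ^ (ε * k) := Real.rpow_le_rpow_of_exponent_le hp1 hkε
      _ = ((p : ℝ) ^ ε) ^ k := Real.rpow_mul_natCast (by linarith) _ _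
      _ ≤ _ := by gcongr
  exact_mod_cast h
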